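/- A \emph{quandle} is a non-empty set $Q$ with a binary operation $*$ such that $x*x=x$ for all $x$, each right multiplication $x\mapsto x*y$ is a bijection of $Q$ (with inverse written $x\mapsto x*^{-1}y$), and $(x*y)*z=(x*z)*(y*z)$ for all $x,y,z\in Q$. A quandle $Q$ is \emph{right-orderable} if there is a linear order $<$ on $Q$ such that $x<y$ implies $x*z<y*z$ for all $x,y,z\in Q$. The \emph{link quandle} of an oriented link is the quandle presented, from a diagram of the link, by one generator for each arc and one relation for each crossing: if $y$ is the over-arc, $x$ the incoming under-arc and $z$ the outgoing under-arc, the relation is $z=x*y$ at a positive crossing and $z=x*^{-1}y$ at a negative crossing. (Up to isomorphism it does not depend on the diagram.) For integers $m,n\ge 1$ the \emph{torus link} $T(m,n)$ is the closure of the braid $(\sigma_1\sigma_2\cdots\sigma_{m-1})^n$ on $m$ strands, all strands being oriented in the same direction and all crossings of this diagram being positive. \textbf{Theorem.} Let $m,n\ge 2$ be integers such that neither of them is a multiple of the other. Then the link quandle of the torus link $T(m,n)$ is not right-orderable. -/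

import Mathlib

open scoped Quandles

universe u

/-! ### Quandles given by generators and relations

Mathlib writes the quandle operation as a left action. The product `x * y` in the right-handed
convention (where `y` acts on `x`) is `y ◃ x`, and `x *⁻¹ y` is `y ◃⁻¹ x`. -/

/-- Formal quandle words on a set `X` of generators: `op x y` is the word `x * y` and
`inv x y` is the word `x *⁻¹ y`. -/
inductive QuandleWord (X : Type u) : Type u
  | gen (a : X) : QuandleWord X
  | op (x y : QuandleWord X) : QuandleWord X
  | inv (x y : QuandleWord X) : QuandleWord X

/-- The smallest congruence on quandle words that contains the quandle axioms and the given
defining relations `R`. -/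
inductive QuandleWord.Congr {X : Type u} (R : QuandleWord X → QuandleWord X → Prop) :
    QuandleWord X → QuandleWord X → Prop
  | refl (x : QuandleWord X) : Congr R x x
  | symm {x y : QuandleWord X} : Congr R x y → Congr R y x
  | trans {x y z : QuandleWord X} : Congr R x y → Congr R y z → Congr R x z
  | op_congr {x x' y y' : QuandleWord X} :
      Congr R x x' → Congr R y y' → Congr R (.op x y) (.op x' y')
  | inv_congr {x x' y y' : QuandleWord X} :
      Congr R x x' → Congr R y y' → Congr R (.inv x y) (.inv x' y')
  | idem (x : QuandleWord X) : Congr R (.op x x) x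
  | inv_op (x y : QuandleWord X) : Congr R (.inv (.op x y) y) x
  | op_inv (x y : QuandleWord X) : Congr R (.op (.inv x y) y) x
  | distrib (x y z : QuandleWord X) :
      Congr R (.op (.op x y) z) (.op (.op x z) (.op y z))
  | rel {x y : QuandleWord X} : R x y → Congr R x y

/-- The congruence on quandle words, as a setoid. -/
def QuandleWord.setoid {X : Type u} (R : QuandleWord X → QuandleWord X → Prop) :
    Setoid (QuandleWord X) where
  r := QuandleWord.Congr R
  iseqv := ⟨.refl, .symm, .trans⟩

/-- The quandle with generating set `X` and defining relations `R`. -/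
def PresentedQuandle {X : Type u} (R : QuandleWord X → QuandleWord X → Prop) : Type u :=
  Quotient (QuandleWord.setoid R)

instance PresentedQuandle.instQuandle {X : Type u} (R : QuandleWord X → QuandleWord X → Prop) :
    Quandle (PresentedQuandle R) where
  act := Quotient.map₂ (fun y x => .op x y) fun _ _ hy _ _ hx => .op_congr hx hy
  self_distrib := by
    rintro ⟨z⟩ ⟨y⟩ ⟨x⟩
    exact Quotient.sound (.distrib x y z)
  invAct := Quotient.map₂ (fun y x => .inv x y) fun _ _ hy _ _ hx => .inv_congr hx hy
  left_inv := by
    rintro ⟨y⟩ ⟨x⟩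
    exact Quotient.sound (.inv_op x y)
  right_inv := by
    rintro ⟨y⟩ ⟨x⟩
    exact Quotient.sound (.op_inv x y)
  fix := by
    rintro ⟨x⟩
    exact Quotient.sound (.idem x)

/-- A quandle is right-orderable if it has a linear order such that `x < y` implies
`x * z < y * z` for all `x, y, z`. -/
def Quandle.IsRightOrderable (Q : Type u) [Quandle Q] : Prop :=
  ∃ _ : LinearOrder Q, ∀ x y z : Q, x < y → z ◃ x < z ◃ y

/-! ### Link diagrams and link quandles -/

/-- The data of an oriented link diagram that enter its link quandle: the arcs, the crossings, and
at each crossing the over-arc, the under-arc coming in, the under-arc going out (with respect to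
the orientation), and whether the crossing is positive. -/
structure ArcDiagram where
  Arc : Type
  Crossing : Type
  overArc : Crossing → Arc
  underIn : Crossing → Arc
  underOut : Crossing → Arc
  positive : Crossing → Bool

/-- The relation at a crossing with over-arc `y`, incoming under-arc `x` and outgoing under-arc `z`:
`z = x * y` if the crossing is positive and `z = x *⁻¹ y` if it is negative. -/
inductive ArcDiagram.CrossingRel (D : ArcDiagram) :
    QuandleWord D.Arc → QuandleWord D.Arc → Prop
  | pos (c : D.Crossing) : D.positive c = true →
      CrossingRel D (.gen (D.underOut c)) (.op (.gen (D.underIn c)) (.gen (D.overArc c)))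
  | neg (c : D.Crossing) : D.positive c = false →
      CrossingRel D (.gen (D.underOut c)) (.inv (.gen (D.underIn c)) (.gen (D.overArc c)))

/-- The link quandle of a diagram: it is generated by the arcs, with one relation for each
crossing. -/
abbrev ArcDiagram.LinkQuandle (D : ArcDiagram) : Type :=
  PresentedQuandle D.CrossingRel

/-! ### Closed braids -/

/-- A standard generator of the braid group on `m` strands or its inverse. Strands are drawn upwards
and their positions are numbered `0, …, m - 1` from left to right. In the elementary braid with
`positive = true` the strand that goes from position `idx` to position `idx + 1` passes over the
strand that goes from `idx + 1` to `idx` (a positive crossing); with `positive = false` it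
passes under it (a negative crossing). -/
structure BraidLetter (m : ℕ) where
  idx : ℕ
  lt : idx + 1 < m
  positive : Bool

namespace BraidLetter

variable {m : ℕ} (s : BraidLetter m)

/-- The left one of the two positions that are interchanged. -/
def left : Fin m := ⟨s.idx, Nat.lt_of_succ_lt s.lt⟩

/-- The right one of the two positions that are interchanged. -/
def right : Fin m := ⟨s.idx + 1, s.lt⟩

/-- The position of the over-strand below the crossing. -/
def overBot : Fin m := if s.positive then s.left else s.right

/-- The position of the over-strand above the crossing. -/
def overTop : Fin m := if s.positive then s.right else s.left

/-- The position of the under-strand below the crossing. -/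
def underBot : Fin m := if s.positive then s.right else s.left

/-- The position of the under-strand above the crossing. -/
def underTop : Fin m := if s.positive then s.left else s.right

end BraidLetter

/-- A point of a braid diagram off the crossings, up to moving along a strand without meeting a
crossing: a level (level `k` lies just below the `k`-th letter of the word, and the last level is
the top of the braid) and a position. -/
abbrev BraidPoint {m : ℕ} (w : List (BraidLetter m)) : Type :=
  Fin (w.length + 1) × Fin m

/-- Two points of the closure of a braid diagram that are joined by a piece of strand which is not
interrupted by an under-crossing: a strand that does not take part in the crossing goes straight up,
the over-strand goes across, and the closure joins the top of the braid to its bottom. -/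
inductive BraidPoint.Joined {m : ℕ} (w : List (BraidLetter m)) :
    BraidPoint w → BraidPoint w → Prop
  | straight (k : Fin w.length) (p : Fin m) :
      p ≠ (w.get k).left → p ≠ (w.get k).right → Joined w (k.castSucc, p) (k.succ, p)
  | overStrand (k : Fin w.length) :
      Joined w (k.castSucc, (w.get k).overBot) (k.succ, (w.get k).overTop)
  | around (p : Fin m) : Joined w (Fin.last w.length, p) (0, p)

/-- The diagram of the closure of a braid word, with all strands oriented upwards. Its arcs are the
classes of points for the equivalence relation generated by `BraidPoint.Joined`. -/
def closedBraid {m : ℕ} (w : List (BraidLetter m)) : ArcDiagram where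
  Arc := Quot (BraidPoint.Joined w)
  Crossing := Fin w.length
  overArc k := Quot.mk _ (k.castSucc, (w.get k).overBot)
  underIn k := Quot.mk _ (k.castSucc, (w.get k).underBot)
  underOut k := Quot.mk _ (k.succ, (w.get k).underTop)
  positive k := (w.get k).positive

/-- The toric braid `(σ₁ σ₂ ⋯ σ_{m-1}) ^ n` on `m` strands. -/
def toricBraid (m n : ℕ) : List (BraidLetter m) :=
  (List.replicate n
    (List.ofFn fun i : Fin (m - 1) => (⟨i, by omega, true⟩ : BraidLetter m))).flatten

/-- The standard diagram of the torus link `T(m,n)`: the closure of the toric braid. -/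
def torusLink (m n : ℕ) : ArcDiagram := closedBraid (toricBraid m n)

/-! ### Colourings of presented quandles -/

/-! Let `a_j` (index mod `m`) be the label at position `j` of the bottom of the braid. One factor
`σ₁ ⋯ σ_{m-1}` shifts the labels by one position and acts on all of them by the label of its
over-strand. Closing up after `n` factors gives `a_j = Φ (a_{j+n})`, where `Φ` is a composite of `n`
such actions and does not depend on `j`. Iterating, `Φ^[m]` fixes every `a_j`. Under a right order
`Φ` is strictly increasing, so its periodic points are fixed points, and hence `a_0 = Φ (a_n) = a_n`
(`torusLabel_eq_of_isRightOrderable`).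

This equality fails in the link quandle. If `A ^ n = 1` and `B ^ m = 1` in a group, then `a_j ↦ B⁻ʲ
A Bʲ⁺¹` extends to a colouring by the conjugation quandle, so `a_n = a_0` would make `A` commute
with `B ^ n` (`commute_of_torusLabel_eq`). As `m ∤ n`, two cycles of lengths `n` and `m` sharing a
single point violate this (`exists_perm_not_commute_pow`). -/

/-- The value of a quandle word under an assignment of its generators. -/
def QuandleWord.eval {X Q : Type*} [Quandle Q] (f : X → Q) : QuandleWord X → Q
  | .gen a => f a
  | .op x y => y.eval f ◃ x.eval f
  | .inv x y => y.eval f ◃⁻¹ x.eval f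

theorem QuandleWord.Congr.eval_eq {X Q : Type*} [Quandle Q]
    {R : QuandleWord X → QuandleWord X → Prop} (f : X → Q) (hf : ∀ x y, R x y → x.eval f = y.eval f) {x y : QuandleWord X}
    (h : QuandleWord.Congr R x y) : x.eval f = y.eval f := by
  induction h with
  | refl x => rfl
  | symm _ ih => exact ih.symm
  | trans _ _ ih₁ ih₂ => exact ih₁.trans ih₂
  | op_congr _ _ ih₁ ih₂ => simp only [QuandleWord.eval, ih₁, ih₂]
  | inv_congr _ _ ih₁ ih₂ => simp only [QuandleWord.eval, ih₁, ih₂]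
  | idem x => exact Quandle.fix
  | inv_op x y => exact Rack.left_inv _ _
  | op_inv x y => exact Rack.right_inv _ _
  | distrib x y z => exact Shelf.self_distrib
  | rel h => exact hf _ _ h

/-- The element of the link quandle given by an arc. -/
def ArcDiagram.arcClass (D : ArcDiagram) (a : D.Arc) : D.LinkQuandle :=
  Quotient.mk (QuandleWord.setoid D.CrossingRel) (.gen a)

theorem ArcDiagram.arcClass_underOut (D : ArcDiagram) (c : D.Crossing) (hc : D.positive c = true) :
    D.arcClass (D.underOut c) = D.arcClass (D.overArc c) ◃ D.arcClass (D.underIn c) :=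
  Quotient.sound (.rel (.pos c hc))

/-- A colouring of the arcs of a positive diagram that satisfies the crossing relations
factors through the link quandle. -/
theorem ArcDiagram.eq_of_arcClass_eq (D : ArcDiagram) {Q : Type*} [Quandle Q] (f : D.Arc → Q)
    (hpos : ∀ c, D.positive c = true)
    (hf : ∀ c, f (D.underOut c) = f (D.overArc c) ◃ f (D.underIn c)) {a b : D.Arc}
    (h : D.arcClass a = D.arcClass b) : f a = f b := by
  refine QuandleWord.Congr.eval_eq f ?_ (Quotient.exact h)
  rintro _ _ (⟨c, -⟩ | ⟨c, hc⟩)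
  · exact hf c
  · simp [hpos c] at hc

/-! ### The toric braid -/

theorem List.getElem_flatten_replicate {α : Type*} (l : List α) (n k : ℕ)
    (hk : k < (List.replicate n l).flatten.length) (hl : k % l.length < l.length) :
    (List.replicate n l).flatten[k] = l[k % l.length] := by
  induction n generalizing k with
  | zero => simp at hk
  | succ n ih =>
    simp only [List.replicate_succ, List.flatten_cons]
    rw [List.getElem_append]
    split_ifs with h
    · simp only [Nat.mod_eq_of_lt h]
    · rw [ih]
      · congr 1
        exact (Nat.mod_eq_sub_mod (not_lt.1 h)).symm
      · rw [← Nat.mod_eq_sub_mod (not_lt.1 h)]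
        exact hl

theorem toricBraid_length (m n : ℕ) : (toricBraid m n).length = n * (m - 1) := by
  simp [toricBraid]

theorem toricBraid_get (m n : ℕ) (hm : 2 ≤ m) (k : Fin (toricBraid m n).length) :
    (toricBraid m n).get k =
      ⟨k % (m - 1), by have := Nat.mod_lt k (show 0 < m - 1 by omega); omega, true⟩ := by
  have hl : (k : ℕ) % (m - 1) < m - 1 := Nat.mod_lt _ (by omega)
  have h := List.getElem_flatten_replicate
    (List.ofFn fun i : Fin (m - 1) => (⟨i, by omega, true⟩ : BraidLetter m)) n k k.2 (by simpa)
  simp only [List.get_eq_getElem]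
  exact h.trans (by simp)

theorem torusLink_positive {m n : ℕ} (hm : 2 ≤ m) (c : (torusLink m n).Crossing) :
    (torusLink m n).positive c = true :=
  congrArg BraidLetter.positive (toricBraid_get m n hm c)

/-- The element of the link quandle of `T(m,n)` at a given level and position, both taken modulo
their number. -/
def torusLabel (m n : ℕ) [NeZero m] (k p : ℕ) : (torusLink m n).LinkQuandle :=
  (torusLink m n).arcClass (Quot.mk _ (Fin.ofNat _ k, Fin.ofNat m p))

section Labels

variable {m n : ℕ} [NeZero m]

theorem torusLabel_of_joined {x y : BraidPoint (toricBraid m n)} (h : BraidPoint.Joined _ x y) :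
    torusLabel m n x.1 x.2 = torusLabel m n y.1 y.2 := by
  have := congrArg (torusLink m n).arcClass (Quot.sound h)
  simpa [torusLabel] using this

theorem torusLabel_mod (k p : ℕ) : torusLabel m n k (p % m) = torusLabel m n k p := by
  have : Fin.ofNat m (p % m) = Fin.ofNat m p := by ext; simp
  rw [torusLabel, this, torusLabel]

theorem torusLabel_top (p : ℕ) : torusLabel m n (n * (m - 1)) p = torusLabel m n 0 p := by
  have h := torusLabel_of_joined (.around (w := toricBraid m n) (Fin.ofNat m p))
  simpa [toricBraid_length, torusLabel_mod] using h

theorem torusLabel_straight (hm : 2 ≤ m) {k p : ℕ} (hk : k < n * (m - 1)) (hp : p < m)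
    (h₁ : p ≠ k % (m - 1)) (h₂ : p ≠ k % (m - 1) + 1) :
    torusLabel m n (k + 1) p = torusLabel m n k p := by
  have h := torusLabel_of_joined (.straight (w := toricBraid m n)
    ⟨k, by rwa [toricBraid_length]⟩ ⟨p, hp⟩
    (by rw [toricBraid_get m n hm]; simpa [BraidLetter.left] using h₁)
    (by rw [toricBraid_get m n hm]; simpa [BraidLetter.right] using h₂))
  simpa using h.symm

theorem torusLabel_over (hm : 2 ≤ m) {k : ℕ} (hk : k < n * (m - 1)) :
    torusLabel m n (k + 1) (k % (m - 1) + 1) = torusLabel m n k (k % (m - 1)) := by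
  have h := torusLabel_of_joined (.overStrand (w := toricBraid m n)
    ⟨k, by rwa [toricBraid_length]⟩)
  rw [toricBraid_get m n hm] at h
  simpa [BraidLetter.overBot, BraidLetter.overTop, BraidLetter.left, BraidLetter.right]
    using h.symm

theorem torusLabel_under (hm : 2 ≤ m) {k : ℕ} (hk : k < n * (m - 1)) :
    torusLabel m n (k + 1) (k % (m - 1)) =
      torusLabel m n k (k % (m - 1)) ◃ torusLabel m n k (k % (m - 1) + 1) := by
  have hlen : k < (toricBraid m n).length := by rwa [toricBraid_length]
  have hmod : k % (m - 1) < m - 1 := Nat.mod_lt _ (by omega)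
  have h := (torusLink m n).arcClass_underOut ⟨k, hlen⟩ (torusLink_positive hm _)
  simp only [torusLink, closedBraid] at h
  rw [toricBraid_get m n hm] at h
  have e₁ : Fin.ofNat ((toricBraid m n).length + 1) (k + 1) = Fin.succ ⟨k, hlen⟩ := by
    ext; simp [hlen]
  have e₂ : Fin.ofNat ((toricBraid m n).length + 1) k = Fin.castSucc ⟨k, hlen⟩ := by
    ext; simp; omega
  have e₃ : Fin.ofNat m (k % (m - 1)) = ⟨k % (m - 1), by omega⟩ := by
    ext; exact Nat.mod_eq_of_lt (by omega)
  have e₄ : Fin.ofNat m (k % (m - 1) + 1) = ⟨k % (m - 1) + 1, by omega⟩ := by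
    ext; exact Nat.mod_eq_of_lt (by omega)
  simp only [torusLabel, e₁, e₂, e₃, e₄]
  exact h

/-- The labels inside a factor `σ₁ ⋯ σ_{m-1}` of the toric braid: its first strand passes over the
others, which move one position to the left. -/
theorem torusLabel_within_block (hm : 2 ≤ m) {r : ℕ} (hr : r < n) (i : ℕ) (hi : i ≤ m - 1) :
    (∀ p < i, torusLabel m n (r * (m - 1) + i) p =
        torusLabel m n (r * (m - 1)) 0 ◃ torusLabel m n (r * (m - 1)) (p + 1)) ∧
      torusLabel m n (r * (m - 1) + i) i = torusLabel m n (r * (m - 1)) 0 ∧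
      ∀ p < m, i < p →
        torusLabel m n (r * (m - 1) + i) p = torusLabel m n (r * (m - 1)) p := by
  induction i with
  | zero => simp
  | succ i ih =>
    obtain ⟨h₁, h₂, h₃⟩ := ih (by omega)
    have hk : r * (m - 1) + i < n * (m - 1) := by
      have := Nat.mul_le_mul_right (m - 1) (Nat.succ_le_of_lt hr)
      rw [Nat.succ_mul] at this
      omega
    have hmod : (r * (m - 1) + i) % (m - 1) = i := by
      rw [Nat.mul_add_mod', Nat.mod_eq_of_lt (by omega)]
    have hs := fun p (hp : p < m) => torusLabel_straight hm hk hp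
    have ho := torusLabel_over hm hk
    have hu := torusLabel_under hm hk
    simp only [hmod] at hs ho hu
    simp only [← Nat.add_assoc]
    refine ⟨fun p hp => ?_, ho.trans h₂, fun p hp hip => ?_⟩
    · rcases Nat.lt_succ_iff_lt_or_eq.1 hp with hp | rfl
      · rw [hs p (by omega) (by omega) (by omega), h₁ p hp]
      · rw [hu, h₂, h₃ _ (by omega) (by omega)]
    · rw [hs p hp (by omega) (by omega), h₃ p hp (by omega)]

/-- The over-strand ends at position `m - 1` with its label `x` unchanged. Since `x ◃ x = x`, the
shift formula also covers that position, with positions read cyclically. -/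
theorem torusLabel_block (hm : 2 ≤ m) {r : ℕ} (hr : r < n) (j : ℕ) :
    torusLabel m n ((r + 1) * (m - 1)) j =
      torusLabel m n (r * (m - 1)) 0 ◃ torusLabel m n (r * (m - 1)) (j + 1) := by
  obtain ⟨h₁, h₂, -⟩ := torusLabel_within_block hm hr (m - 1) le_rfl
  rw [← torusLabel_mod _ j, ← torusLabel_mod _ (j + 1), Nat.succ_mul]
  have hj : j % m < m := Nat.mod_lt _ (by omega)
  rcases (show j % m < m - 1 ∨ j % m = m - 1 by omega) with h | h
  · rw [h₁ _ h, Nat.add_mod j 1, Nat.mod_eq_of_lt (show 1 < m by omega),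
      Nat.mod_eq_of_lt (show j % m + 1 < m by omega)]
  · have h0 : (j + 1) % m = 0 := by
      rw [Nat.add_mod, h, Nat.mod_eq_of_lt (show 1 < m by omega), Nat.sub_add_cancel (by omega),
        Nat.mod_self]
    rw [h, h₂, h0, Quandle.fix]

/-- A right order forces the labels at the bottom of the toric braid to have period `n`. -/
theorem torusLabel_eq_of_isRightOrderable (hm : 2 ≤ m)
    (h : Quandle.IsRightOrderable (torusLink m n).LinkQuandle) :
    torusLabel m n 0 n = torusLabel m n 0 0 := by
  obtain ⟨_, hlt⟩ := h
  -- `Φ` composes the actions of the over-strands of the first `r` factors; one map serves all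
  -- positions `j`.
  have key : ∀ r ≤ n, ∃ Φ : (torusLink m n).LinkQuandle → (torusLink m n).LinkQuandle,
      StrictMono Φ ∧ ∀ j, torusLabel m n (r * (m - 1)) j = Φ (torusLabel m n 0 (j + r)) := by
    intro r
    induction r with
    | zero => exact fun _ => ⟨id, strictMono_id, by simp⟩
    | succ r ih =>
      intro hr
      obtain ⟨Φ, hΦ, hj⟩ := ih (by omega)
      refine ⟨fun x => torusLabel m n (r * (m - 1)) 0 ◃ Φ x, fun x y hxy => hlt _ _ _ (hΦ hxy),
        fun j => ?_⟩
      rw [torusLabel_block hm (by omega), hj (j + 1), Nat.add_assoc, Nat.add_comm 1 r]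
  obtain ⟨Φ, hΦ, hj⟩ := key n le_rfl
  simp only [torusLabel_top] at hj
  have hit : ∀ s j, Φ^[s] (torusLabel m n 0 (j + s * n)) = torusLabel m n 0 j := by
    intro s
    induction s with
    | zero => simp
    | succ s ih =>
      intro j
      rw [Function.iterate_succ_apply, Nat.succ_mul, ← Nat.add_assoc, ← hj, ih]
  -- After `m` rounds the index has moved by `m * n`, a multiple of `m`, so the label is the same.
  have hper : Φ^[m] (torusLabel m n 0 n) = torusLabel m n 0 n := by
    conv_rhs => rw [← hit m n]
    rw [← torusLabel_mod _ (n + m * n), Nat.add_mul_mod_self_left, torusLabel_mod]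
  have h0 : torusLabel m n 0 0 = Φ (torusLabel m n 0 n) := by simpa using hj 0
  rw [h0]
  -- If `Φ` moved this label up or down, its iterates would move strictly the same way and could not
  -- return after `m` steps.
  rcases lt_trichotomy (torusLabel m n 0 n) (Φ (torusLabel m n 0 n)) with hl | he | hg
  · have := hΦ.strictMono_iterate_of_lt_map hl (show 0 < m by omega)
    simp [hper] at this
  · exact he
  · have := hΦ.strictAnti_iterate_of_map_lt hg (show 0 < m by omega)
    simp [hper] at this

end Labels

/-! ### Colourings of torus links by conjugation quandles -/

/-- The colour at position `j` after `r` factors of the toric braid. -/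
def torusColor {G : Type*} [Group G] (A B : G) (r j : ℕ) : G :=
  A ^ r * (B ^ j)⁻¹ * A * B ^ j * B * (A ^ r)⁻¹

/-- At `j = 0` the colour is the conjugate of `A * B` by `A ^ r`. Conjugating by `A * B` absorbs one
factor `B` of the position and leaves a conjugation by `A`, so each factor of the braid advances `r`
and shifts `j`. -/
theorem torusColor_conj {G : Type*} [Group G] (A B : G) (r j : ℕ) :
    torusColor A B r 0 * torusColor A B r (j + 1) * (torusColor A B r 0)⁻¹ =
      torusColor A B (r + 1) j := by
  simp only [torusColor, pow_succ]
  group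

theorem torusColor_last {G : Type*} [Group G] (A B : G) {m : ℕ} (hm : 1 ≤ m) (hB : B ^ m = 1)
    (r : ℕ) : torusColor A B (r + 1) (m - 1) = torusColor A B r 0 := by
  have h : B ^ (m - 1) = B⁻¹ := by
    rw [eq_inv_iff_mul_eq_one, ← pow_succ, Nat.sub_add_cancel hm, hB]
  simp only [torusColor, h, pow_succ]
  group

/-- The colour at level `k` and position `p` of the toric braid. -/
def torusPointColor {G : Type*} [Group G] (A B : G) (m k p : ℕ) : G :=
  if p < k % (m - 1) then torusColor A B (k / (m - 1) + 1) p
  else if p = k % (m - 1) then torusColor A B (k / (m - 1)) 0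
  else torusColor A B (k / (m - 1)) p

/-- The case formula for level `k` with its threshold raised by one. It stays valid when `k + 1`
starts a new factor: the arriving over-strand then has the colour required there by
`torusColor_last`. -/
theorem torusPointColor_succ {G : Type*} [Group G] (A B : G) {m : ℕ} (hm : 2 ≤ m)
    (hB : B ^ m = 1) {k p : ℕ} (hp : p < m) :
    torusPointColor A B m (k + 1) p =
      if p < k % (m - 1) + 1 then torusColor A B (k / (m - 1) + 1) p
      else if p = k % (m - 1) + 1 then torusColor A B (k / (m - 1)) 0
      else torusColor A B (k / (m - 1)) p := by
  have hlt : k % (m - 1) < m - 1 := Nat.mod_lt _ (by omega)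
  have hdm := Nat.div_add_mod k (m - 1)
  rcases (show k % (m - 1) + 1 < m - 1 ∨ k % (m - 1) + 1 = m - 1 by omega) with h | h
  · have h1 : (k + 1) / (m - 1) = k / (m - 1) := by
      rw [Nat.div_eq_iff (by omega), Nat.mul_comm]; omega
    have h2 : (k + 1) % (m - 1) = k % (m - 1) + 1 := by
      have := Nat.div_add_mod (k + 1) (m - 1)
      rw [h1] at this; omega
    simp only [torusPointColor, h1, h2]
  · have hk : k + 1 = (k / (m - 1) + 1) * (m - 1) := by
      rw [Nat.succ_mul, Nat.mul_comm]; omega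
    have h1 : (k + 1) / (m - 1) = k / (m - 1) + 1 := by
      conv_lhs => rw [hk, Nat.mul_div_cancel _ (by omega)]
    have h2 : (k + 1) % (m - 1) = 0 := by
      conv_lhs => rw [hk, Nat.mul_mod_left]
    simp only [torusPointColor, h1, h2, h]
    have hl := torusColor_last A B (by omega) hB (k / (m - 1))
    grind

theorem torusPointColor_straight {G : Type*} [Group G] (A B : G) {m : ℕ} (hm : 2 ≤ m)
    (hB : B ^ m = 1) {k p : ℕ} (hp : p < m) (h₁ : p ≠ k % (m - 1)) (h₂ : p ≠ k % (m - 1) + 1) :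
    torusPointColor A B m (k + 1) p = torusPointColor A B m k p := by
  rw [torusPointColor_succ A B hm hB hp, torusPointColor]
  split_ifs <;> first | rfl | omega

theorem torusPointColor_over {G : Type*} [Group G] (A B : G) {m : ℕ} (hm : 2 ≤ m)
    (hB : B ^ m = 1) (k : ℕ) :
    torusPointColor A B m (k + 1) (k % (m - 1) + 1) = torusPointColor A B m k (k % (m - 1)) := by
  have hlt : k % (m - 1) < m - 1 := Nat.mod_lt _ (by omega)
  rw [torusPointColor_succ A B hm hB (by omega), torusPointColor]
  simp

theorem torusPointColor_under {G : Type*} [Group G] (A B : G) {m : ℕ} (hm : 2 ≤ m)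
    (hB : B ^ m = 1) (k : ℕ) :
    torusPointColor A B m (k + 1) (k % (m - 1)) =
      torusPointColor A B m k (k % (m - 1)) * torusPointColor A B m k (k % (m - 1) + 1) *
        (torusPointColor A B m k (k % (m - 1)))⁻¹ := by
  have hlt : k % (m - 1) < m - 1 := Nat.mod_lt _ (by omega)
  rw [torusPointColor_succ A B hm hB (by omega)]
  simp [torusPointColor, torusColor_conj]

theorem torusPointColor_zero {G : Type*} [Group G] (A B : G) (m p : ℕ) :
    torusPointColor A B m 0 p = torusColor A B 0 p := by
  simp only [torusPointColor, Nat.zero_mod, Nat.zero_div]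
  split_ifs with h₁ h₂
  · omega
  · rw [h₂]
  · rfl

theorem torusPointColor_top {G : Type*} [Group G] (A B : G) {m n : ℕ} (hm : 2 ≤ m)
    (hA : A ^ n = 1) (p : ℕ) :
    torusPointColor A B m (n * (m - 1)) p = torusPointColor A B m 0 p := by
  simp only [torusPointColor, Nat.mul_mod_left, Nat.mul_div_cancel _ (show 0 < m - 1 by omega),
    Nat.zero_mod, Nat.zero_div]
  simp [torusColor, hA]

/-- If the labels at the bottom of the toric braid have period `n`, then `A` commutes with `B ^ n`
whenever `A ^ n = 1` and `B ^ m = 1`. -/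
theorem commute_of_torusLabel_eq {G : Type*} [Group G] (A B : G) {m n : ℕ} [NeZero m] (hm : 2 ≤ m)
    (hA : A ^ n = 1) (hB : B ^ m = 1) (h : torusLabel m n 0 n = torusLabel m n 0 0) :
    A * B ^ n = B ^ n * A := by
  let f : (torusLink m n).Arc → Quandle.Conj G :=
    Quot.lift (fun x : BraidPoint (toricBraid m n) => torusPointColor A B m x.1 x.2) (by
      rintro _ _ (⟨k, p, h₁, h₂⟩ | ⟨k⟩ | ⟨p⟩)
      · rw [toricBraid_get m n hm] at h₁ h₂
        simp only [BraidLetter.left, BraidLetter.right, ne_eq, Fin.ext_iff] at h₁ h₂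
        exact (torusPointColor_straight A B hm hB p.2 h₁ h₂).symm
      · rw [toricBraid_get m n hm]
        exact (torusPointColor_over A B hm hB k).symm
      · simpa [toricBraid_length] using torusPointColor_top A B hm hA p)
  have hf : ∀ c, f ((torusLink m n).underOut c) =
      f ((torusLink m n).overArc c) ◃ f ((torusLink m n).underIn c) := by
    intro (c : Fin (toricBraid m n).length)
    change f (Quot.mk _ (c.succ, ((toricBraid m n).get c).underTop)) =
      f (Quot.mk _ (c.castSucc, ((toricBraid m n).get c).overBot)) ◃
        f (Quot.mk _ (c.castSucc, ((toricBraid m n).get c).underBot))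
    rw [toricBraid_get m n hm]
    exact torusPointColor_under A B hm hB c
  have key := (torusLink m n).eq_of_arcClass_eq f (torusLink_positive hm) hf h
  have key' : torusPointColor A B m 0 (n % m) = torusPointColor A B m 0 (0 % m) := by
    simpa [f] using key
  rw [torusPointColor_zero, torusPointColor_zero, Nat.zero_mod] at key'
  have hn : B ^ (n % m) = B ^ n := by
    conv_rhs => rw [← Nat.mod_add_div n m, pow_add, pow_mul, hB, one_pow, mul_one]
  simp only [torusColor, hn, pow_zero, inv_one, one_mul, mul_one] at key'
  have := mul_right_cancel key'
  rw [mul_assoc, inv_mul_eq_iff_eq_mul] at this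
  exact this

/-! ### Two cycles that meet in a point -/

/-- The cycle along the axis `{0} × ℤ/n` of the product `α × ℤ/n`. -/
def axisCycle (α : Type*) [Zero α] [DecidableEq α] (n : ℕ) : Equiv.Perm (α × ZMod n) :=
  Equiv.prodShear (Equiv.refl α) fun x => if x = 0 then Equiv.addRight 1 else Equiv.refl _

theorem axisCycle_pow_apply (α : Type*) [Zero α] [DecidableEq α] (n k : ℕ) (x : α × ZMod n) :
    (axisCycle α n ^ k) x = if x.1 = 0 then (x.1, x.2 + k) else x := by
  induction k with
  | zero => simp
  | succ k ih =>
    rw [pow_succ', Equiv.Perm.mul_apply, ih]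
    by_cases h : x.1 = 0
    · simp [axisCycle, h, add_assoc]
    · simp [axisCycle, h]

theorem axisCycle_pow_self (α : Type*) [Zero α] [DecidableEq α] (n : ℕ) :
    axisCycle α n ^ n = 1 := by
  ext1 x
  rw [axisCycle_pow_apply]
  simp

/-- There are a permutation of order dividing `n` and one of order dividing `m` such that the first
does not commute with the `n`-th power of the second. -/
theorem exists_perm_not_commute_pow {m n : ℕ} (hn : 2 ≤ n) (hmn : ¬ m ∣ n) :
    ∃ A B : Equiv.Perm (ZMod m × ZMod n), A ^ n = 1 ∧ B ^ m = 1 ∧ A * B ^ n ≠ B ^ n * A := by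
  let e := (Equiv.prodComm (ZMod n) (ZMod m)).permCongrHom
  refine ⟨axisCycle (ZMod m) n, e (axisCycle (ZMod n) m), axisCycle_pow_self _ _, ?_, fun h => ?_⟩
  · rw [← map_pow, axisCycle_pow_self, map_one]
  · have hn0 : (n : ZMod m) ≠ 0 := by rwa [ne_eq, ZMod.natCast_eq_zero_iff]
    have : Fact (1 < n) := ⟨hn⟩
    have h₁ := axisCycle_pow_apply (ZMod m) n 1
    rw [pow_one] at h₁
    -- At the common point of the cycles, `A * B ^ n` gives `(n, 0)`, which `A` fixes because `n ≠
    -- 0` mod `m`, while `B ^ n * A` gives `(0, 1)`, which `B` fixes because `1 ≠ 0` mod `n`.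
    have h₂ := DFunLike.congr_fun h (0, 0)
    rw [← map_pow] at h₂
    simp [e, Equiv.permCongrHom, axisCycle_pow_apply, h₁, hn0] at h₂

theorem theorem5p2 (m n : ℕ) (hm : 2 ≤ m) (hn : 2 ≤ n) (hmn : ¬ m ∣ n) (hnm : ¬ n ∣ m) :
    ¬ Quandle.IsRightOrderable (torusLink m n).LinkQuandle := by
  intro h
  have : NeZero m := ⟨by omega⟩
  obtain ⟨A, B, hA, hB, hAB⟩ := exists_perm_not_commute_pow hn hmn
  exact hAB (commute_of_torusLabel_eq A B hm hA hB (torusLabel_eq_of_isRightOrderable hm h))
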